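/- A partial word over an alphabet $\mathcal A$ is a finite sequence over $\mathcal A\cup\{\diamond\}$, where $\diamond$ (the hole) is not a letter; its hole density is its number of holes divided by its length. Two partial words are compatible if they have the same length and agree at every position where both have a letter. A partial word $w$ over $\mathcal A$ encounters a pattern $p\in\mathcal V^*$ if some factor (block of consecutive characters) of $w$ is compatible with $h(p)$ for some nonerasing morphism $h:\mathcal V^*\to\mathcal A^*$. The Zimin patterns are $Z_1=a_1$ and $Z_i=Z_{i-1}a_iZ_{i-1}$ for $i\ge 2$, where $a_1,a_2,\dots$ are distinct variables. For an integer $m\ge1$ and $d\in\mathbb Q\cap(0,1)$, the partial Ramsey length $L_d(m,p)$ is the least $n\ge1$ such that partial words of length $n$ with hole density $d$ over an $m$-letter alphabet exist and every one of them encounters $p$. Corollary. For all integers $m,i\ge1$ and all $d\in\mathbb Q\cap(0,1)$, $$L_d(m,Z_i)\ \ge\ (1+o(1))\sqrt{2\prod_{j=1}^{i-1}\left(\frac{m^{2^j-1}}{[1+d(m-1)]^{2^j}-\left(1-\frac1m\right)(md)^{2^j}}-1\right)},$$ where $o(1)$ denotes a real quantity depending on $m$, $i$, $d$ that tends to $0$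 as $\max(m,i)\to\infty$, uniformly in $d$. -/

import Mathlib

/-- A partial word over `A`: a finite sequence over `A` extended by the hole character `none`. -/
abbrev PartialWord (A : Type*) := List (Option A)

namespace PartialWord

/-- The number of holes of a partial word divided by its length. -/
def holeDensity {A : Type*} (w : PartialWord A) : ℚ :=
  (w.countP Option.isNone : ℚ) / (w.length : ℚ)

/-- `u ↑ v`: the words have equal length and agree wherever both carry letters. -/
def Compatible {A : Type*} (u v : PartialWord A) : Prop :=
  List.Forall₂ (fun x y => ∀ a b : A, x = some a → y = some b → a = b) u v

/-- The full word `v`, seen as a partial word without holes. -/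
def ofWord {A : Type*} (v : List A) : PartialWord A := v.map some

/-- `w` encounters the pattern `p`: some factor of `w` is compatible with `h(p)` for a nonerasing
morphism `h`. The morphism is given by its nonempty values on letters; its value on `p` is the
concatenation of the values on the letters of `p`. -/
def Encounters {V A : Type*} (w : PartialWord A) (p : List V) : Prop :=
  ∃ h : V → List A, (∀ x, h x ≠ []) ∧
    ∃ f : PartialWord A, f <:+: w ∧ Compatible f (ofWord (p.flatMap h))

end PartialWord

/-- The Zimin patterns `Z₁ = a₁`, `Zᵢ₊₁ = Zᵢ aᵢ₊₁ Zᵢ`, with the natural number `i` as the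
variable `aᵢ` (and `Z₀` empty). -/
def zimin : ℕ → List ℕ
  | 0 => []
  | i + 1 => zimin i ++ [i + 1] ++ zimin i

/-- The partial Ramsey length `L_d(m, p)`: the least length `n ≥ 1` for which partial words of
length `n` and hole density `d` over an `m`-letter alphabet exist and all of them encounter `p`. -/
noncomputable def partialRamseyLength {V : Type*} (d : ℚ) (m : ℕ) (p : List V) : ℕ :=
  sInf {n : ℕ | 0 < n ∧
    (∃ w : PartialWord (Fin m), w.length = n ∧ w.holeDensity = d) ∧
    ∀ w : PartialWord (Fin m), w.length = n → w.holeDensity = d → w.Encounters p}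

/-!
Fix a length `n`, a number `h = d n` of holes, and a pattern `p` in which one variable `x` occurs
exactly once and every other variable at least twice. If every partial word with these parameters
encounters `p`, then so does a random one, whose holes form a uniformly random `h`-subset of the
positions and whose letters are independent and uniform. We bound the expected number of
encounters from above, once for each starting position and each choice of lengths `l y` of the
images of the variables.

Such an encounter splits the covered positions into blocks, one for each letter of the images, and
requires the letters of each block to agree outside the holes. The hole counts of disjoint blocks
are negatively associated, so the probabilities multiply up to an inequality. For a block of `k`
positions, drawing the holes without replacement instead of independently with density `d` costs a
factor of at most `(n / (n - 1)) ^ (k - 1)`. If the variables other than `x` cover `s` positions,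
the total cost is at most `n / (n - s + 1)`, and it is absorbed by the count of the starting
positions and lengths of the image of `x`, which is `(n - s + 1) * (n - s) / 2` only: their product
is at most `n ^ 2 / 2`. Summing geometric series over the `l y` gives
`1 ≤ n ^ 2 / 2 * ∏ y ≠ x, (1 / q y - 1)⁻¹`, where `q y` is the probability that the positions of
one letter of the image of `y` agree. For a Zimin pattern this is the claimed bound, without any
error term.
-/

open Finset
open scoped BigOperators

section UniformSubset

variable {α : Type*} [DecidableEq α]

theorem sum_powersetCard_succ_sum_erase (B : Finset α) (j : ℕ) (F : Finset α → ℝ) :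
    ∑ T ∈ powersetCard (j + 1) B, ∑ t ∈ T, F (T.erase t)
      = ∑ R ∈ powersetCard j B, ∑ _t ∈ B \ R, F R := by
  rw [sum_sigma', sum_sigma']
  refine sum_bij' (fun x _ => ⟨x.1.erase x.2, x.2⟩) (fun x _ => ⟨insert x.2 x.1, x.2⟩)
    ?_ ?_ ?_ ?_ fun _ _ => rfl
  · rintro ⟨T, t⟩ h
    simp only [mem_sigma, mem_powersetCard, mem_sdiff] at h ⊢
    refine ⟨⟨(erase_subset _ _).trans h.1.1, ?_⟩, h.1.1 h.2, notMem_erase _ _⟩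
    rw [card_erase_of_mem h.2, h.1.2, Nat.add_sub_cancel]
  · rintro ⟨R, t⟩ h
    simp only [mem_sigma, mem_powersetCard, mem_sdiff] at h ⊢
    refine ⟨⟨insert_subset h.2.1 h.1.1, ?_⟩, mem_insert_self _ _⟩
    rw [card_insert_of_notMem h.2.2, h.1.2]
  · rintro ⟨T, t⟩ h
    simp only [mem_sigma, mem_powersetCard] at h
    simp [insert_erase h.2]
  · rintro ⟨R, t⟩ h
    simp only [mem_sigma, mem_powersetCard, mem_sdiff] at h
    simp [erase_insert h.2.2]

theorem expect_powersetCard_succ_expect_erase {B : Finset α} {j : ℕ} (hj : j < #B)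
    (F : Finset α → ℝ) :
    𝔼 T ∈ powersetCard (j + 1) B, 𝔼 t ∈ T, F (T.erase t) = 𝔼 R ∈ powersetCard j B, F R := by
  have inner : ∀ T ∈ powersetCard (j + 1) B,
      𝔼 t ∈ T, F (T.erase t) = (∑ t ∈ T, F (T.erase t)) / ((j : ℝ) + 1) := fun T hT => by
    rw [expect_eq_sum_div_card, (mem_powersetCard.1 hT).2, Nat.cast_add_one]
  have outer : ∀ R ∈ powersetCard j B, ∑ _t ∈ B \ R, F R = ((#B - j : ℕ) : ℝ) * F R :=
    fun R hR => by
      rw [sum_const, nsmul_eq_mul, card_sdiff_of_subset (mem_powersetCard.1 hR).1,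
        (mem_powersetCard.1 hR).2]
  have hcard : ((#B).choose (j + 1) : ℝ) * ((j : ℝ) + 1)
      = ((#B).choose j : ℝ) * ((#B - j : ℕ) : ℝ) := by
    exact_mod_cast Nat.choose_succ_right_eq #B j
  rw [expect_congr rfl inner, ← expect_div, expect_eq_sum_div_card, expect_eq_sum_div_card,
    sum_powersetCard_succ_sum_erase, sum_congr rfl outer, ← mul_sum, card_powersetCard,
    card_powersetCard, div_div, hcard, mul_comm ((#B).choose j : ℝ), mul_div_mul_left]
  exact_mod_cast (Nat.sub_pos_of_lt hj).ne'

omit [DecidableEq α] in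
theorem expect_powersetCard_mono (B : Finset α) {F : Finset α → ℝ} (hF : Monotone F)
    {j j' : ℕ} (hj : j ≤ j') (hB : j' ≤ #B) :
    𝔼 S ∈ powersetCard j B, F S ≤ 𝔼 S ∈ powersetCard j' B, F S := by
  classical
  induction j', hj using Nat.le_induction with
  | base => exact le_rfl
  | succ l _ ih =>
    refine (ih (by omega)).trans ?_
    rw [← expect_powersetCard_succ_expect_erase hB]
    refine expect_le_expect fun T hT => expect_le ?_ fun t _ => hF (erase_subset t T)
    exact card_pos.1 (by rw [(mem_powersetCard.1 hT).2]; omega)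

variable [Fintype α]

theorem sum_powersetCard_split (G : Finset α) (h : ℕ) (φ : ℕ → ℝ) {F : Finset α → ℝ}
    (hF : ∀ H, F (H \ G) = F H) :
    ∑ H ∈ powersetCard h univ, φ #(H ∩ G) * F H
      = ∑ a ∈ range (h + 1), (#G).choose a * (φ a * ∑ S ∈ powersetCard (h - a) Gᶜ, F S) := by
  have product : ∀ a ∈ range (h + 1),
      (#G).choose a * (φ a * ∑ S ∈ powersetCard (h - a) Gᶜ, F S)
        = ∑ x ∈ powersetCard a G ×ˢ powersetCard (h - a) Gᶜ, φ a * F x.2 := fun a _ => by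
    simp only [sum_product, sum_const, card_powersetCard, nsmul_eq_mul, mul_sum]
  have split : ∀ {A S}, A ⊆ G → S ⊆ Gᶜ → (A ∪ S) ∩ G = A ∧ (A ∪ S) \ G = S := by
    intro A S hA hS
    have hS : Disjoint S G := disjoint_compl_left.mono_left hS
    rw [union_inter_distrib_right, union_sdiff_distrib, inter_eq_left.2 hA,
      sdiff_eq_empty_iff_subset.2 hA, disjoint_iff_inter_eq_empty.1 hS,
      sdiff_eq_self_of_disjoint hS, union_empty, empty_union]
    exact ⟨rfl, rfl⟩
  rw [sum_congr rfl product, sum_sigma']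
  refine sum_bij' (fun H _ => ⟨#(H ∩ G), H ∩ G, H \ G⟩) (fun x _ => x.2.1 ∪ x.2.2) ?_ ?_ ?_ ?_
    fun H _ => by rw [hF]
  · intro H hH
    have hH := (mem_powersetCard.1 hH).2
    have := card_inter_add_card_sdiff H G
    simp only [mem_sigma, mem_range, mem_product, mem_powersetCard]
    exact ⟨by omega, ⟨inter_subset_right, trivial⟩,
      fun x hx => mem_compl.2 (mem_sdiff.1 hx).2, by omega⟩
  · rintro ⟨a, A, S⟩ hx
    simp only [mem_sigma, mem_range, mem_product, mem_powersetCard] at hx ⊢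
    obtain ⟨ha, ⟨hA, hAa⟩, hS, hSa⟩ := hx
    have := card_inter_add_card_sdiff (A ∪ S) G
    rw [(split hA hS).1, (split hA hS).2] at this
    exact ⟨subset_univ _, by omega⟩
  · exact fun H _ => (union_comm _ _).trans (sdiff_union_inter H G)
  · rintro ⟨a, A, S⟩ hx
    simp only [mem_sigma, mem_range, mem_product, mem_powersetCard] at hx
    obtain ⟨-, ⟨hA, rfl⟩, hS, -⟩ := hx
    simp only [split hA hS]

/-- Given the number of its elements in `G`, a uniformly random set has a uniformly random trace on
`Gᶜ`. -/
theorem expect_powersetCard_mul_eq_expect_mul_condExpect (G : Finset α) (h : ℕ) (φ : ℕ → ℝ)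
    {F : Finset α → ℝ} (hF : ∀ H, F (H \ G) = F H) :
    𝔼 H ∈ powersetCard h univ, φ #(H ∩ G) * F H
      = 𝔼 H ∈ powersetCard h univ,
          φ #(H ∩ G) * 𝔼 S ∈ powersetCard (h - #(H ∩ G)) Gᶜ, F S := by
  have conditional := sum_powersetCard_split G h
    (fun a => φ a * 𝔼 S ∈ powersetCard (h - a) Gᶜ, F S) (F := fun _ => 1) fun _ => rfl
  simp only [mul_one, sum_const, nsmul_one] at conditional
  simp only [expect_eq_sum_div_card (powersetCard h univ), sum_powersetCard_split G h φ hF,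
    conditional, ← card_mul_expect (powersetCard _ Gᶜ) F, mul_assoc,
    mul_comm (#(powersetCard _ Gᶜ) : ℝ)]

theorem expect_powersetCard_mul_le (G : Finset α) (h : ℕ) {φ : ℕ → ℝ} (hφ : Monotone φ)
    {F : Finset α → ℝ} (hFm : Monotone F) (hF : ∀ H, F (H \ G) = F H) :
    𝔼 H ∈ powersetCard h univ, φ #(H ∩ G) * F H
      ≤ (𝔼 H ∈ powersetCard h univ, φ #(H ∩ G)) * 𝔼 H ∈ powersetCard h univ, F H := by
  set C : Finset α → ℝ := fun H => 𝔼 S ∈ powersetCard (h - #(H ∩ G)) Gᶜ, F S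
  have expect_C : 𝔼 H ∈ powersetCard h univ, F H = 𝔼 H ∈ powersetCard h univ, C H := by
    simpa only [one_mul] using
      expect_powersetCard_mul_eq_expect_mul_condExpect G h (fun _ => 1) hF
  have C_anti : ∀ H ∈ powersetCard h (univ : Finset α), ∀ H', #(H ∩ G) ≤ #(H' ∩ G) →
      C H' ≤ C H := fun H hH H' hHH' => by
    have hH := (mem_powersetCard.1 hH).2
    have : #(H \ G) ≤ #Gᶜ := card_le_card fun x hx => mem_compl.2 (mem_sdiff.1 hx).2
    have := card_inter_add_card_sdiff H G
    exact expect_powersetCard_mono Gᶜ hFm (by omega) (by omega)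
  have antivary : AntivaryOn (fun H => φ #(H ∩ G)) C (powersetCard h (univ : Finset α)) :=
    fun H hH H' _ hlt => hφ (not_lt.1 fun hcard => hlt.not_ge (C_anti H hH H' hcard.le))
  rw [expect_powersetCard_mul_eq_expect_mul_condExpect G h φ hF, expect_C,
    expect_eq_sum_div_card, expect_eq_sum_div_card, expect_eq_sum_div_card, div_mul_div_comm]
  obtain hs | hs := (powersetCard h (univ : Finset α)).eq_empty_or_nonempty
  · simp [hs]
  · have hpos : (0 : ℝ) < #(powersetCard h (univ : Finset α)) := by exact_mod_cast hs.card_pos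
    rw [← mul_div_mul_left _ _ hpos.ne']
    exact div_le_div_of_nonneg_right antivary.card_mul_sum_le_sum_mul_sum (by positivity)

theorem expect_powersetCard_prod_le {ι : Type*} (s : Finset ι) {G : ι → Finset α}
    (hG : (s : Set ι).PairwiseDisjoint G) (h : ℕ) {φ : ι → ℕ → ℝ}
    (hφ : ∀ i, Monotone (φ i)) (hφ0 : ∀ i a, 0 ≤ φ i a) :
    𝔼 H ∈ powersetCard h univ, ∏ i ∈ s, φ i #(H ∩ G i)
      ≤ ∏ i ∈ s, 𝔼 H ∈ powersetCard h univ, φ i #(H ∩ G i) := by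
  classical
  induction s using Finset.induction_on with
  | empty =>
    obtain hs | hs := (powersetCard h (univ : Finset α)).eq_empty_or_nonempty
    · simp [hs]
    · simp [expect_const hs]
  | insert i s hi ih =>
    have hdisj : ∀ j ∈ s, Disjoint (G i) (G j) := fun j hj =>
      hG (mem_coe.2 (mem_insert_self i s)) (mem_coe.2 (mem_insert_of_mem hj))
        (ne_of_mem_of_not_mem hj hi).symm
    simp only [prod_insert hi]
    refine (expect_powersetCard_mul_le (G i) h (hφ i) (F := fun H => ∏ j ∈ s, φ j #(H ∩ G j))
      ?_ ?_).trans ?_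
    · exact fun H H' hHH' => prod_le_prod (fun j _ => hφ0 _ _) fun j _ =>
        hφ j (card_le_card (inter_subset_inter_right hHH'))
    · refine fun H => prod_congr rfl fun j hj => ?_
      rw [sdiff_inter_right_comm, sdiff_eq_self_of_disjoint
        ((hdisj j hj).symm.mono_left inter_subset_right)]
    · exact mul_le_mul_of_nonneg_left (ih (hG.subset (coe_subset.2 (subset_insert i s))))
        (expect_nonneg fun H _ => hφ0 _ _)

theorem expect_powersetCard_ite_subset (S : Finset α) {h : ℕ} (hh : h ≤ Fintype.card α) :
    𝔼 H ∈ powersetCard h univ, (if S ⊆ H then 1 else 0 : ℝ)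
      = (h.choose #S : ℝ) / (Fintype.card α).choose #S := by
  rw [expect_eq_sum_div_card, sum_boole, card_powersetCard, card_univ, div_eq_div_iff
    (by exact_mod_cast (Nat.choose_pos hh).ne')
    (by exact_mod_cast (Nat.choose_pos (card_le_univ S)).ne')]
  obtain hS | hS := le_or_gt #S h
  · have := Nat.choose_mul (n := Fintype.card α) hS
    rw [card_filter_powersetCard_subset _ _ _ (subset_univ S) hS, card_univ,
      mul_comm (h.choose _ : ℝ)]
    exact_mod_cast (mul_comm _ _).trans this.symm
  · rw [filter_false_of_mem fun H hH hSH =>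
      hS.not_ge ((card_le_card hSH).trans_eq (mem_powersetCard.1 hH).2),
      Nat.choose_eq_zero_of_lt hS]
    simp

end UniformSubset

section ChooseRatio

theorem choose_div_choose_le_pow {h n : ℕ} (hh : h ≤ n) (r : ℕ) :
    (h.choose r : ℝ) / n.choose r ≤ (h / n : ℝ) ^ r := by
  induction r generalizing h n with
  | zero => simp
  | succ r ih =>
    obtain _ | h := h
    · simp
    obtain _ | n := n
    · omega
    have hh : h ≤ n := Nat.le_of_succ_le_succ hh
    have mono : (h / n : ℝ) ≤ ((h + 1 : ℕ) : ℝ) / (n + 1 : ℕ) := by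
      obtain rfl | hn := Nat.eq_zero_or_pos n
      · simp only [Nat.cast_zero, div_zero]; positivity
      · rw [div_le_div_iff₀ (by positivity) (by positivity)]
        push_cast
        have : (h : ℝ) ≤ n := by exact_mod_cast hh
        linarith
    have absorb : ∀ a : ℕ, ((a + 1).choose (r + 1) : ℝ) = (a + 1 : ℕ) * a.choose r / (r + 1) :=
      fun a => by
        rw [eq_div_iff (by positivity)]
        exact_mod_cast (Nat.add_one_mul_choose_eq a r).symm
    calc ((h + 1).choose (r + 1) : ℝ) / (n + 1).choose (r + 1)
        = ((h + 1 : ℕ) : ℝ) / (n + 1 : ℕ) * ((h.choose r : ℝ) / n.choose r) := by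
          rw [absorb, absorb, div_div_div_cancel_right₀ (by positivity), div_mul_div_comm]
      _ ≤ ((h + 1 : ℕ) : ℝ) / (n + 1 : ℕ) * (((h + 1 : ℕ) : ℝ) / (n + 1 : ℕ)) ^ r := by
          gcongr
          exact (ih hh).trans (by gcongr)
      _ = _ := (pow_succ' _ _).symm

theorem choose_div_choose_sub_succ (h : ℕ) {n r : ℕ} (hr : r ≤ n) :
    (h.choose r : ℝ) / (n + 1).choose r - (h.choose (r + 1) : ℝ) / (n + 1).choose (r + 1)
      = (1 - h / (n + 1)) * (h.choose r / n.choose r) := by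
  have succ_h : (h.choose (r + 1) : ℝ) * (r + 1) = h.choose r * (h - r) := by
    obtain hrh | hrh := le_or_gt r h
    · rw [← Nat.cast_sub hrh]; exact_mod_cast Nat.choose_succ_right_eq h r
    · simp [Nat.choose_eq_zero_of_lt hrh, Nat.choose_eq_zero_of_lt (hrh.trans r.lt_succ_self)]
  have succ_n : ((n + 1).choose (r + 1) : ℝ) * (r + 1) = (n + 1 : ℝ) * n.choose r := by
    exact_mod_cast (Nat.add_one_mul_choose_eq n r).symm
  have upper_n : (n.choose r : ℝ) * (n + 1) = (n + 1).choose r * (n + 1 - r) := by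
    have := Nat.choose_mul_succ_eq n r
    rw [← Nat.cast_add_one, ← Nat.cast_sub (by omega)]
    exact_mod_cast this
  have hc : (0 : ℝ) < n.choose r := by exact_mod_cast Nat.choose_pos hr
  have hr' : (0 : ℝ) < r + 1 := by positivity
  have hr : (0 : ℝ) < n + 1 - r := by
    have : (r : ℝ) ≤ n := by exact_mod_cast hr
    linarith
  rw [eq_div_of_mul_eq hr'.ne' succ_h, eq_div_of_mul_eq hr'.ne' succ_n,
    eq_div_of_mul_eq hr.ne' upper_n.symm]
  field_simp
  ring

theorem choose_div_choose_sub_le {h n r k : ℕ} (hn : 0 < n) (hh : h ≤ n) (hrk : r ≤ k)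
    (hk : k ≤ n + 1) :
    (h.choose r : ℝ) / (n + 1).choose r - (h.choose k : ℝ) / (n + 1).choose k
      ≤ ((n + 1) / n : ℝ) ^ (k - 1) * ((h / (n + 1) : ℝ) ^ r - (h / (n + 1) : ℝ) ^ k) := by
  have hn : (0 : ℝ) < n := by exact_mod_cast hn
  have hh' : (h : ℝ) ≤ n := by exact_mod_cast hh
  have hd : (h / (n + 1) : ℝ) ≤ 1 := by rw [div_le_one (by positivity)]; linarith
  have hK : (1 : ℝ) ≤ (n + 1) / n := by rw [one_le_div hn]; linarith
  induction k, hrk using Nat.le_induction with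
  | base => simp
  | succ k hrk ih =>
    have step : (h.choose k : ℝ) / (n + 1).choose k
          - (h.choose (k + 1) : ℝ) / (n + 1).choose (k + 1)
        ≤ ((n + 1) / n : ℝ) ^ k * ((h / (n + 1) : ℝ) ^ k - (h / (n + 1) : ℝ) ^ (k + 1)) :=
      calc _ = (1 - h / (n + 1) : ℝ) * (h.choose k / n.choose k) :=
            choose_div_choose_sub_succ h (by omega)
        _ ≤ (1 - h / (n + 1) : ℝ) * (h / n : ℝ) ^ k :=
            mul_le_mul_of_nonneg_left (choose_div_choose_le_pow hh k) (by linarith)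
        _ = _ := by
            rw [show (h / n : ℝ) = (n + 1) / n * (h / (n + 1)) by field_simp, mul_pow]
            ring
    have decreasing : (h / (n + 1) : ℝ) ^ k ≤ (h / (n + 1) : ℝ) ^ r :=
      pow_le_pow_of_le_one (by positivity) hd hrk
    calc _ ≤ ((n + 1) / n : ℝ) ^ (k - 1) * ((h / (n + 1) : ℝ) ^ r - (h / (n + 1) : ℝ) ^ k)
          + ((n + 1) / n : ℝ) ^ k * ((h / (n + 1) : ℝ) ^ k - (h / (n + 1) : ℝ) ^ (k + 1)) := by
          linarith [ih (by omega)]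
      _ ≤ ((n + 1) / n : ℝ) ^ k * ((h / (n + 1) : ℝ) ^ r - (h / (n + 1) : ℝ) ^ k)
          + ((n + 1) / n : ℝ) ^ k * ((h / (n + 1) : ℝ) ^ k - (h / (n + 1) : ℝ) ^ (k + 1)) := by
          have := pow_le_pow_right₀ hK (Nat.sub_le k 1)
          exact add_le_add_left (mul_le_mul_of_nonneg_right this (sub_nonneg.2 decreasing)) _
      _ = _ := by rw [Nat.add_sub_cancel]; ring

end ChooseRatio

section AgreeProb

/-- The probability that `k` independent characters, each a hole with probability `d` and otherwise
a uniformly random one of `m` letters, carry at most one letter: the first term counts, for each of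
the `m` letters, the words without any other letter, and the second corrects for the all-hole word,
which has been counted `m` times. -/
noncomputable def agreeProb (m k : ℕ) (d : ℝ) : ℝ :=
  m * (d + (1 - d) / m) ^ k - (m - 1) * d ^ k

/-- The coefficients that expand the weight of a block of `k` positions, and its expectation, over
the subsets of the block: the coefficient of each subset of size `r`. -/
noncomputable def blockCoeff (m k r : ℕ) : ℝ :=
  m * ((1 - (m : ℝ)⁻¹) ^ r * (m : ℝ)⁻¹ ^ (k - r))

theorem blockCoeff_nonneg (m k r : ℕ) : 0 ≤ blockCoeff m k r := by
  have : 0 ≤ 1 - (m : ℝ)⁻¹ := sub_nonneg.2 (Nat.cast_inv_le_one m)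
  unfold blockCoeff
  positivity

theorem agreeProb_card_eq_sum_blockCoeff {α : Type*} (m : ℕ) (G : Finset α) (d : ℝ) :
    agreeProb m #G d = ∑ S ∈ G.powerset, blockCoeff m #G #S * (d ^ #S - d ^ #G) + d ^ #G := by
  have total : ∑ S ∈ G.powerset, blockCoeff m #G #S = m := by
    simp only [blockCoeff, ← mul_sum, sum_pow_mul_eq_add_pow, sub_add_cancel, one_pow, mul_one]
  have moment : ∑ S ∈ G.powerset, blockCoeff m #G #S * d ^ #S = m * (d + (1 - d) / m) ^ #G := by
    rw [show d + (1 - d) / m = (1 - (m : ℝ)⁻¹) * d + (m : ℝ)⁻¹ by ring, ← sum_pow_mul_eq_add_pow,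
      mul_sum]
    exact sum_congr rfl fun S _ => by rw [blockCoeff, mul_pow]; ring
  simp only [mul_sub, sum_sub_distrib, ← sum_mul, total, moment, agreeProb]
  ring

theorem sum_powerset_mul_ite_subset {α : Type*} [DecidableEq α] (G H : Finset α) (a b : ℝ) :
    ∑ S ∈ G.powerset, a ^ #S * b ^ (#G - #S) * (if S ⊆ H then 1 else 0)
      = (a + b) ^ #(G ∩ H) * b ^ #(G \ H) := by
  have filter_eq : {S ∈ G.powerset | S ⊆ H} = (G ∩ H).powerset := by
    ext S; simp only [mem_filter, mem_powerset, subset_inter_iff]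
  simp only [mul_ite, mul_one, mul_zero]
  rw [← sum_filter, filter_eq, ← sum_pow_mul_eq_add_pow, sum_mul]
  refine sum_congr rfl fun S hS => ?_
  have := card_le_card (mem_powerset.1 hS)
  rw [mul_assoc, ← pow_add, ← card_inter_add_card_sdiff G H]
  congr 2
  omega

theorem inv_pow_card_sdiff_sub_one_eq_sum_blockCoeff {α : Type*} [DecidableEq α] {m : ℕ}
    (hm : 0 < m) (G H : Finset α) :
    (m : ℝ)⁻¹ ^ (#(G \ H) - 1)
      = ∑ S ∈ G.powerset, blockCoeff m #G #S
          * ((if S ⊆ H then 1 else 0) - (if G ⊆ H then 1 else 0)) + (if G ⊆ H then 1 else 0) := by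
  by_cases hGH : G ⊆ H
  · rw [sum_eq_zero fun S hS => by simp [hGH, (mem_powerset.1 hS).trans hGH]]
    simp [hGH, sdiff_eq_empty_iff_subset.2 hGH]
  · have hm : (m : ℝ) ≠ 0 := by exact_mod_cast hm.ne'
    obtain ⟨r, hr⟩ := Nat.exists_eq_add_one.2 (card_pos.2 (sdiff_nonempty.2 hGH))
    simp only [hGH, if_false, sub_zero, add_zero, blockCoeff, mul_assoc (m : ℝ), ← mul_sum,
      sum_powerset_mul_ite_subset, sub_add_cancel, one_pow, one_mul, hr, pow_succ']
    rw [Nat.add_sub_cancel, mul_inv_cancel_left₀ hm]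

theorem expect_inv_pow_card_sdiff_le {α : Type*} [DecidableEq α] [Fintype α] {m h : ℕ}
    (hm : 0 < m) (hn : 1 < Fintype.card α) (hh : h < Fintype.card α) (G : Finset α) :
    𝔼 H ∈ powersetCard h univ, (m : ℝ)⁻¹ ^ (#(G \ H) - 1)
      ≤ ((Fintype.card α : ℝ) / (Fintype.card α - 1)) ^ (#G - 1)
        * agreeProb m #G (h / Fintype.card α) := by
  obtain ⟨n, hcard⟩ := Nat.exists_eq_add_one.2 (pos_of_gt hn)
  have hGn : #G ≤ n + 1 := hcard ▸ card_le_univ G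
  have expect_subset := fun S : Finset α => expect_powersetCard_ite_subset S hh.le
  simp only [inv_pow_card_sdiff_sub_one_eq_sum_blockCoeff hm, expect_add_distrib, expect_sum_comm,
    ← mul_expect, expect_sub_distrib, expect_subset, agreeProb_card_eq_sum_blockCoeff, mul_add,
    mul_sum]
  rw [hcard] at hn hh ⊢
  push_cast
  rw [add_sub_cancel_right]
  refine add_le_add (sum_le_sum fun S hS => ?_) ?_
  · rw [mul_left_comm]
    exact mul_le_mul_of_nonneg_left (choose_div_choose_sub_le (by omega) (by omega)
      (card_le_card (mem_powerset.1 hS)) hGn) (blockCoeff_nonneg m #G #S)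
  · have hn : (0 : ℝ) < n := by exact_mod_cast Nat.succ_lt_succ_iff.1 hn
    have factor : (1 : ℝ) ≤ ((n + 1) / n : ℝ) ^ (#G - 1) :=
      one_le_pow₀ ((one_le_div hn).2 (by linarith))
    have := choose_div_choose_le_pow hh.le #G
    push_cast at this
    exact this.trans (le_mul_of_one_le_left (by positivity) factor)

theorem agreeProb_one (m : ℕ) (hm : 0 < m) (d : ℝ) : agreeProb m 1 d = 1 := by
  have : (m : ℝ) ≠ 0 := by exact_mod_cast hm.ne'
  unfold agreeProb; field_simp; ring

theorem agreeProb_one_left (k : ℕ) (d : ℝ) : agreeProb 1 k d = 1 := by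
  simp [agreeProb]

theorem agreeProb_pos {m : ℕ} (hm : 0 < m) (k : ℕ) {d : ℝ} (hd0 : 0 ≤ d) (hd1 : d < 1) :
    0 < agreeProb m k d := by
  have hm : (1 : ℝ) ≤ m := by exact_mod_cast hm
  have hle : d ^ k ≤ (d + (1 - d) / m) ^ k := by
    have : 0 ≤ (1 - d) / m := div_nonneg (by linarith) (by linarith)
    gcongr
    linarith
  have hpos : 0 < (d + (1 - d) / m) ^ k := by
    have : 0 < (1 - d) / m := div_pos (by linarith) (by linarith)
    positivity
  unfold agreeProb
  linarith [mul_nonneg (sub_nonneg.2 hm) (sub_nonneg.2 hle)]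

theorem agreeProb_lt_one {m k : ℕ} (hm : 2 ≤ m) (hk : 2 ≤ k) {d : ℝ} (hd0 : 0 ≤ d)
    (hd1 : d < 1) : agreeProb m k d < 1 := by
  have hm' : (2 : ℝ) ≤ m := by exact_mod_cast hm
  have hq : d < d + (1 - d) / m := by
    have : 0 < (1 - d) / m := div_pos (by linarith) (by linarith)
    linarith
  have hmq : m * (d + (1 - d) / m) = m * d + 1 - d := by field_simp; ring
  have decreasing : ∀ k ≠ 0, agreeProb m (k + 1) d < agreeProb m k d := fun k hk => by
    have hstep : agreeProb m k d - agreeProb m (k + 1) d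
        = (m - 1) * (1 - d) * ((d + (1 - d) / m) ^ k - d ^ k) := by
      unfold agreeProb; linear_combination -(d + (1 - d) / m) ^ k * hmq
    have : d ^ k < (d + (1 - d) / m) ^ k := pow_lt_pow_left₀ hq hd0 hk
    have : 0 < (m - 1) * (1 - d) * ((d + (1 - d) / m) ^ k - d ^ k) :=
      mul_pos (mul_pos (by linarith) (by linarith)) (by linarith)
    linarith
  induction k, hk using Nat.le_induction with
  | base => exact (decreasing 1 one_ne_zero).trans_eq (agreeProb_one m (by omega) d)
  | succ k hk ih => exact (decreasing k (by omega)).trans ih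

theorem inv_agreeProb_sub_one_eq {m : ℕ} (hm : 0 < m) {k : ℕ} (hk : 0 < k) (d : ℝ) :
    1 / agreeProb m k d - 1 = (m : ℝ) ^ (k - 1)
      / ((1 + d * ((m : ℝ) - 1)) ^ k - (1 - 1 / (m : ℝ)) * ((m : ℝ) * d) ^ k) - 1 := by
  have hm : (m : ℝ) ≠ 0 := by exact_mod_cast hm.ne'
  obtain ⟨k, rfl⟩ := Nat.exists_eq_add_one.2 hk
  have : (1 + d * ((m : ℝ) - 1)) ^ (k + 1) - (1 - 1 / (m : ℝ)) * ((m : ℝ) * d) ^ (k + 1)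
      = (m : ℝ) ^ k * agreeProb m (k + 1) d := by
    rw [agreeProb, show d + (1 - d) / m = (1 + d * (m - 1)) / m by field_simp; ring, div_pow]
    field_simp
    ring
  rw [this, Nat.add_sub_cancel, div_mul_cancel_left₀ (pow_ne_zero k hm), one_div]

end AgreeProb

section Fillings

/-- The functions on `α` that are constant on each of the sets `B i` with `i ∈ s`. -/
def constantOnBlocks {α ι : Type*} (β : Type*) [Fintype α] [DecidableEq α] [Fintype β]
    [DecidableEq β] (s : Finset ι) (B : ι → Finset α) : Finset (α → β) :=
  {v | ∀ i ∈ s, ∀ y ∈ B i, ∀ z ∈ B i, v y = v z}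

theorem mem_constantOnBlocks {α β ι : Type*} [Fintype α] [DecidableEq α] [Fintype β]
    [DecidableEq β] {s : Finset ι} {B : ι → Finset α} {v : α → β} :
    v ∈ constantOnBlocks β s B ↔ ∀ i ∈ s, ∀ y ∈ B i, ∀ z ∈ B i, v y = v z := by
  simp [constantOnBlocks]

theorem injOn_restrict_compl_constantOnBlocks {α β ι : Type*} [Fintype α] [DecidableEq α]
    [Fintype β] [DecidableEq β] {s : Finset ι} {B R : ι → Finset α}
    (hB : (s : Set ι).PairwiseDisjoint B) (hRB : ∀ i, R i ⊆ B i)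
    (hR : ∀ i, ∀ x ∈ R i, ∃ y ∈ B i, y ∉ R i) :
    Set.InjOn (fun (v : α → β) (x : ↥(s.biUnion R)ᶜ) => v x) (constantOnBlocks β s B) := by
  intro v hv w hw hvw
  rw [mem_coe, mem_constantOnBlocks] at hv hw
  have outside : ∀ x ∉ s.biUnion R, v x = w x := fun x hx => congrFun hvw ⟨x, mem_compl.2 hx⟩
  funext x
  by_cases hx : x ∈ s.biUnion R
  · obtain ⟨i, hi, hxi⟩ := mem_biUnion.1 hx
    obtain ⟨y, hy, hyR⟩ := hR i x hxi
    rw [hv i hi x (hRB i hxi) y hy, hw i hi x (hRB i hxi) y hy]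
    refine outside y fun hyD => ?_
    obtain ⟨j, hj, hyj⟩ := mem_biUnion.1 hyD
    obtain rfl | hij := eq_or_ne i j
    · exact hyR hyj
    · exact disjoint_left.1 (hB hi hj hij) hy (hRB j hyj)
  · exact outside x hx

theorem dens_constantOnBlocks_le {α ι : Type*} (β : Type*) [Fintype α] [DecidableEq α] [Fintype β]
    [DecidableEq β] [Nonempty β] (s : Finset ι) {B : ι → Finset α}
    (hB : (s : Set ι).PairwiseDisjoint B) :
    (dens (constantOnBlocks β s B) : ℝ)
      ≤ ∏ i ∈ s, (Fintype.card β : ℝ)⁻¹ ^ (#(B i) - 1) := by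
  classical
  have exists_all_but_one : ∀ i, ∃ R ⊆ B i, #R = #(B i) - 1 ∧ ∀ x ∈ R, ∃ y ∈ B i, y ∉ R := by
    intro i
    obtain h | ⟨y, hy⟩ := (B i).eq_empty_or_nonempty
    · exact ⟨∅, by simp [h]⟩
    · exact ⟨(B i).erase y, erase_subset _ _, card_erase_of_mem hy,
        fun _ _ => ⟨y, hy, notMem_erase _ _⟩⟩
  choose R hRB hRcard hR using exists_all_but_one
  have card_biUnion_eq : #(s.biUnion R) = ∑ i ∈ s, (#(B i) - 1) := by
    rw [card_biUnion fun i hi j hj hij => (hB hi hj hij).mono (hRB i) (hRB j)]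
    exact sum_congr rfl fun i _ => hRcard i
  have hcard := card_le_card_of_injOn (t := univ) _ (fun _ _ => mem_coe.2 (mem_univ _))
    (injOn_restrict_compl_constantOnBlocks (β := β) hB hRB hR)
  rw [card_univ, Fintype.card_fun, Fintype.card_coe, card_compl] at hcard
  have hβ : (Fintype.card β : ℝ) ≠ 0 := by exact_mod_cast Fintype.card_ne_zero
  rw [nnratCast_dens, Fintype.card_fun, prod_pow_eq_pow_sum, ← card_biUnion_eq,
    div_le_iff₀ (by positivity)]
  calc _ ≤ ((Fintype.card β ^ (Fintype.card α - #(s.biUnion R)) : ℕ) : ℝ) := by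
        exact_mod_cast hcard
    _ = _ := by
      push_cast
      rw [pow_sub₀ _ hβ (card_le_univ _), inv_pow, mul_comm]

variable {X : Type*} [DecidableEq X]

/-- The positions of a word of length `n` that carry the label `x` when the list `L` of labels is
written from position `a` on. -/
def labelBlock (n a : ℕ) (L : List X) (x : X) : Finset (Fin n) :=
  {z | a ≤ z ∧ L[z - a]? = some x}

theorem mem_labelBlock {n a : ℕ} {L : List X} {x : X} {z : Fin n} :
    z ∈ labelBlock n a L x ↔ a ≤ z ∧ L[z - a]? = some x := by
  simp [labelBlock]

theorem card_labelBlock {n a : ℕ} {L : List X} (hL : a + L.length ≤ n) (x : X) :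
    #(labelBlock n a L x) = L.count x := by
  refine (Eq.trans ?_ (Fin.card_filter_univ_eq_vector_get_eq_count x ⟨L, rfl⟩))
  refine (card_bij (fun i _ => ⟨a + i, by omega⟩) ?_ ?_ ?_).symm
  · intro i hi
    have hi : L[i.1] = x := (mem_filter.1 hi).2
    exact mem_labelBlock.2 ⟨Nat.le_add_right a i, by simp [hi]⟩
  · intro i _ j _ hij
    simpa [Fin.ext_iff] using hij
  · intro z hz
    obtain ⟨haz, hz⟩ := mem_labelBlock.1 hz
    obtain ⟨hlt, hz⟩ := List.getElem?_eq_some_iff.1 hz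
    exact ⟨⟨z - a, hlt⟩, mem_filter.2 ⟨mem_univ _, hz⟩, Fin.ext (Nat.add_sub_cancel' haz)⟩

theorem pairwiseDisjoint_labelBlock (n a : ℕ) (L : List X) (s : Set X) :
    s.PairwiseDisjoint (labelBlock n a L) := fun _ _ _ _ hxy =>
  disjoint_left.2 fun _ hzx hzy => hxy (Option.some_injective _
    ((mem_labelBlock.1 hzx).2.symm.trans (mem_labelBlock.1 hzy).2))

variable (A : Type*) [Fintype A] [DecidableEq A]

/-- The words of length `n` over `A` which, once the positions in `H` are punched out, are
compatible with a full word repeating from position `a` on the repetitions in the list `L` of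
labels: outside `H`, equal labels carry equal letters. -/
def labelledFillings (n a : ℕ) (L : List X) (H : Finset (Fin n)) : Finset (Fin n → A) :=
  constantOnBlocks A L.toFinset fun x => labelBlock n a L x \ H

theorem expect_dens_labelledFillings_le [Nonempty A] {n h a : ℕ} (hn : 1 < n) (hh : h < n)
    {L : List X} (hL : a + L.length ≤ n) :
    𝔼 H ∈ powersetCard h univ, (dens (labelledFillings A n a L H) : ℝ)
      ≤ ∏ x ∈ L.toFinset, ((n : ℝ) / (n - 1)) ^ (L.count x - 1)
          * agreeProb (Fintype.card A) (L.count x) (h / n) := by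
  have hA : (1 : ℝ) ≤ Fintype.card A := by exact_mod_cast Fintype.card_pos
  set φ : X → ℕ → ℝ := fun x j => (Fintype.card A : ℝ)⁻¹ ^ (#(labelBlock n a L x) - j - 1)
  have hφ : ∀ x, Monotone (φ x) := fun x j k hjk =>
    pow_le_pow_of_le_one (by positivity) (inv_le_one_of_one_le₀ hA) (by omega)
  have φ_eq : ∀ x H, φ x #(H ∩ labelBlock n a L x)
      = (Fintype.card A : ℝ)⁻¹ ^ (#(labelBlock n a L x \ H) - 1) := fun x H => by rw [card_sdiff]
  calc 𝔼 H ∈ powersetCard h univ, (dens (labelledFillings A n a L H) : ℝ)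
      ≤ 𝔼 H ∈ powersetCard h univ, ∏ x ∈ L.toFinset, φ x #(H ∩ labelBlock n a L x) := by
        refine expect_le_expect fun H _ => ?_
        simp only [φ_eq]
        exact dens_constantOnBlocks_le A L.toFinset fun x hx y hy hxy =>
          (pairwiseDisjoint_labelBlock n a L _ hx hy hxy).mono sdiff_subset sdiff_subset
    _ ≤ ∏ x ∈ L.toFinset, 𝔼 H ∈ powersetCard h univ, φ x #(H ∩ labelBlock n a L x) :=
        expect_powersetCard_prod_le _ (pairwiseDisjoint_labelBlock n a L _) h hφ
          fun x j => by positivity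
    _ ≤ _ := by
        refine prod_le_prod (fun x _ => expect_nonneg fun H _ => by positivity) fun x _ => ?_
        have block := expect_inv_pow_card_sdiff_le (m := Fintype.card A) (h := h)
          Fintype.card_pos (by rwa [Fintype.card_fin]) (by rwa [Fintype.card_fin])
          (labelBlock n a L x)
        rw [Fintype.card_fin, card_labelBlock hL] at block
        simpa only [φ_eq] using block

end Fillings

section PatternLabels

variable {V : Type*}

/-- The labels of the positions of `h(p)` for a morphism `h` with `|h(x)| = l x`: the label `⟨x, c⟩`
stands for the letter of `h(x)` with index `c`. -/
def patternLabels (p : List V) (l : V → ℕ) : List (Σ _ : V, ℕ) :=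
  p.sigma fun x => List.range (l x)

theorem map_some_flatMap_eq_map_patternLabels {A : Type*} (p : List V) (h : V → List A) :
    (p.flatMap h).map some
      = (patternLabels p fun x => (h x).length).map fun y => (h y.1)[y.2]? := by
  have map_range : ∀ g : List A, g.map some = (List.range g.length).map fun c => g[c]? :=
    fun g => List.ext_getElem? fun k => by
      obtain hk | hk := lt_or_ge k g.length <;> simp [hk]
  rw [List.map_flatMap, patternLabels, List.sigma, List.map_flatMap]
  simp only [map_range, List.map_map, Function.comp_def]

variable [DecidableEq V]

theorem toFinset_patternLabels (p : List V) (l : V → ℕ) :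
    (patternLabels p l).toFinset = p.toFinset.sigma fun x => range (l x) := by
  ext ⟨x, c⟩
  simp [patternLabels]

theorem count_patternLabels (p : List V) {l : V → ℕ} {x : V} {c : ℕ} (hc : c < l x) :
    (patternLabels p l).count ⟨x, c⟩ = p.count x := by
  induction p with
  | nil => simp [patternLabels]
  | cons y p ih =>
    have hmap : ((List.range (l y)).map (Sigma.mk y)).count (⟨x, c⟩ : Σ _ : V, ℕ)
        = if y = x then 1 else 0 := by
      split_ifs with hyx
      · subst hyx
        rw [List.count_map_of_injective _ _ sigma_mk_injective,
          List.count_eq_one_of_mem List.nodup_range (List.mem_range.2 hc)]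
      · exact List.count_eq_zero.2 fun hmem => by
          obtain ⟨c', -, heq⟩ := List.mem_map.1 hmem
          exact hyx (congrArg Sigma.fst heq)
    rw [patternLabels, List.sigma_cons, List.count_append, hmap, ← patternLabels, ih,
      List.count_cons, add_comm]
    simp only [beq_iff_eq]

theorem length_patternLabels (p : List V) (l : V → ℕ) :
    (patternLabels p l).length = ∑ x ∈ p.toFinset, p.count x * l x := by
  simp [patternLabels, List.length_sigma, sum_list_map_count]

theorem prod_toFinset_patternLabels (p : List V) (l : V → ℕ) (f : ℕ → ℝ) :
    ∏ y ∈ (patternLabels p l).toFinset, f ((patternLabels p l).count y)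
      = ∏ x ∈ p.toFinset, f (p.count x) ^ l x := by
  rw [toFinset_patternLabels, prod_sigma]
  refine prod_congr rfl fun x _ => ?_
  rw [prod_congr rfl fun c hc => by rw [count_patternLabels p (mem_range.1 hc)], prod_const,
    card_range]

end PatternLabels

namespace PartialWord

variable {A : Type*} {n : ℕ}

/-- The full word `v` with holes punched at the positions in `H`. -/
def punch (H : Finset (Fin n)) (v : Fin n → A) : PartialWord A :=
  List.ofFn fun z => if z ∈ H then none else some (v z)

@[simp]
theorem length_punch (H : Finset (Fin n)) (v : Fin n → A) : (punch H v).length = n :=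
  List.length_ofFn

theorem holeDensity_punch (H : Finset (Fin n)) (v : Fin n → A) :
    (punch H v).holeDensity = (#H : ℚ) / n := by
  have isNone_eq : (Option.isNone ∘ fun z => if z ∈ H then none else some (v z))
      = fun z => decide (z ∈ H) := by
    funext z; by_cases hz : z ∈ H <;> simp [hz]
  have count_holes : (punch H v).countP Option.isNone = #H := by
    rw [punch, List.ofFn_eq_map, List.countP_map, isNone_eq, List.countP_eq_length_filter,
      ← List.toFinset_card_of_nodup ((List.nodup_finRange n).filter _)]
    congr 1
    ext z; simp
  rw [holeDensity, count_holes, length_punch]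

theorem Encounters.exists_mem_labelledFillings {V : Type*} [DecidableEq V] [Fintype A]
    [DecidableEq A] {H : Finset (Fin n)} {v : Fin n → A} {p : List V}
    (hw : (punch H v).Encounters p) :
    ∃ l : V → ℕ, (∀ x, 0 < l x) ∧ ∃ a, a + (patternLabels p l).length ≤ n ∧
      v ∈ labelledFillings A n a (patternLabels p l) H := by
  obtain ⟨h, hne, f, ⟨u, u', huf⟩, hcompat⟩ := hw
  rw [Compatible, ofWord, map_some_flatMap_eq_map_patternLabels, List.forall₂_iff_get] at hcompat
  set L := patternLabels p fun x => (h x).length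
  obtain ⟨hlength, hagree⟩ := hcompat
  rw [List.length_map] at hlength
  have letter : ∀ x, ∀ y ∈ labelBlock n u.length L x \ H, (h x.1)[x.2]? = some (v y) := by
    intro x y hy
    obtain ⟨hyblock, hyH⟩ := mem_sdiff.1 hy
    obtain ⟨huy, hLy⟩ := mem_labelBlock.1 hyblock
    obtain ⟨hlt, hLy⟩ := List.getElem?_eq_some_iff.1 hLy
    have hfy : f[y - u.length]'(by omega) = some (v y) := by
      have : (punch H v)[y.1]'(by simp) = some (v y) := by simp [punch, hyH]
      rw [← this]
      simp only [← huf]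
      rw [List.getElem_append_left (by rw [List.length_append]; omega),
        List.getElem_append_right huy]
    have hx : x ∈ L := hLy ▸ List.getElem_mem hlt
    obtain ⟨c, hc⟩ : ∃ c, (h x.1)[x.2]? = some c := by
      have : x.2 < (h x.1).length := List.mem_range.1 (List.mem_sigma.1 hx).2
      exact ⟨_, List.getElem?_eq_getElem this⟩
    have := hagree (y - u.length) (by omega) (by simpa using hlt) (v y) c (by simpa using hfy)
      (by simpa [hLy] using hc)
    rw [hc, this]
  refine ⟨fun x => (h x).length, fun x => List.length_pos_iff.2 (hne x), u.length, ?_, ?_⟩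
  · have := congrArg List.length huf
    simp only [List.length_append, length_punch] at this
    change u.length + L.length ≤ n
    omega
  · exact mem_constantOnBlocks.2 fun x _ y hy z hz =>
      Option.some_injective _ ((letter x y hy).symm.trans (letter x z hz))

end PartialWord

section FirstMoment

variable {V : Type*}

theorem patternLabels_congr {p : List V} {l l' : V → ℕ} (h : ∀ y ∈ p, l y = l' y) :
    patternLabels p l = patternLabels p l' :=
  List.flatMap_congr fun y hy => by simp only [h y hy]

theorem div_sub_one_pow_le {n M : ℕ} (hM : M < n) (hn : 1 < n) :
    ((n : ℝ) / (n - 1)) ^ M ≤ n / (n - M) := by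
  have hn' : (1 : ℝ) < n := by exact_mod_cast hn
  have hM' : (M : ℝ) < n := by exact_mod_cast hM
  have hbase : (n : ℝ) / (n - 1) = (1 + -(1 / (n : ℝ)))⁻¹ := by
    rw [← inv_div, inv_inj]
    field_simp
    ring
  have hfrac : (n : ℝ) / (n - M) = (1 + M * -(1 / (n : ℝ)))⁻¹ := by
    field_simp
    ring
  have hpos : 0 < 1 + M * -(1 / (n : ℝ)) := by
    rw [← inv_pos, ← hfrac]
    exact div_pos (by linarith) (by linarith)
  rw [hbase, hfrac, inv_pow]
  refine inv_anti₀ hpos (one_add_mul_le_pow ?_ M)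
  have : 1 / (n : ℝ) ≤ 1 := (div_le_one (by linarith)).2 hn'.le
  linarith

variable [DecidableEq V] {A : Type*} [Fintype A] [DecidableEq A] {n h : ℕ} {p : List V} {x : V}

theorem length_patternLabels_update (hx : p.count x = 1) (l : V → ℕ) (r : ℕ) :
    (patternLabels p (Function.update l x r)).length
      = ∑ y ∈ p.toFinset.erase x, p.count y * l y + r := by
  have hxp : x ∈ p.toFinset := List.mem_toFinset.2 (List.count_pos_iff.1 (by omega))
  rw [length_patternLabels, ← sum_erase_add _ _ hxp, Function.update_self, hx, one_mul,
    sum_congr rfl fun y hy => by rw [Function.update_of_ne (ne_of_mem_erase hy)]]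

theorem expect_dens_labelledFillings_update_le [Nonempty A] {a r : ℕ} {l : V → ℕ}
    (hx : p.count x = 1) (hY : (p.toFinset.erase x).Nonempty)
    (hl : ∀ y ∈ p.toFinset.erase x, 0 < l y) (hr : 0 < r) (hh : h < n)
    (ha : a + (∑ y ∈ p.toFinset.erase x, p.count y * l y + r) ≤ n) :
    𝔼 H ∈ powersetCard h univ,
        (dens (labelledFillings A n a (patternLabels p (Function.update l x r)) H) : ℝ)
      ≤ n / (n - (∑ y ∈ p.toFinset.erase x, p.count y * l y : ℕ) + 1)
        * ∏ y ∈ p.toFinset.erase x, agreeProb (Fintype.card A) (p.count y) (h / n) ^ l y := by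
  have hxp : x ∈ p.toFinset := List.mem_toFinset.2 (List.count_pos_iff.1 (by omega))
  have hcount : ∀ y ∈ p.toFinset.erase x, 0 < p.count y := fun y hy =>
    List.count_pos_iff.2 (List.mem_toFinset.1 (mem_of_mem_erase hy))
  set s := ∑ y ∈ p.toFinset.erase x, p.count y * l y
  have exponent_lt : ∑ y ∈ p.toFinset.erase x, (p.count y - 1) * l y < s :=
    sum_lt_sum_of_nonempty hY fun y hy => Nat.mul_lt_mul_of_pos_right
      (Nat.sub_one_lt (hcount y hy).ne') (hl y hy)
  have hn : 1 < n := by omega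
  refine (expect_dens_labelledFillings_le A hn hh
    (by rwa [length_patternLabels_update hx])).trans ?_
  rw [prod_toFinset_patternLabels p _ fun k => ((n : ℝ) / (n - 1)) ^ (k - 1)
      * agreeProb (Fintype.card A) k (h / n), ← prod_erase_mul _ _ hxp, hx,
    agreeProb_one _ Fintype.card_pos, Nat.sub_self, pow_zero, one_mul, one_pow, mul_one,
    prod_congr rfl fun y hy => by rw [Function.update_of_ne (ne_of_mem_erase hy)]]
  simp only [mul_pow, ← pow_mul]
  rw [prod_mul_distrib, prod_pow_eq_pow_sum]
  have hd1 : (h : ℝ) / n < 1 :=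
    (div_lt_one (by exact_mod_cast Nat.zero_lt_of_lt hh)).2 (by exact_mod_cast hh)
  refine mul_le_mul_of_nonneg_right ?_ (prod_nonneg fun y _ =>
    pow_nonneg (agreeProb_pos Fintype.card_pos _ (by positivity) hd1).le _)
  refine (div_sub_one_pow_le (by omega) hn).trans ?_
  have hsn : (s : ℝ) < n := by exact_mod_cast (by omega : s < n)
  have exponent_le : ((∑ y ∈ p.toFinset.erase x, (p.count y - 1) * l y : ℕ) : ℝ) + 1 ≤ s := by
    exact_mod_cast exponent_lt
  exact div_le_div_of_nonneg_left (by positivity) (by linarith) (by linarith)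

theorem sum_expect_dens_labelledFillings_le [Nonempty A] {l : V → ℕ} (hx : p.count x = 1)
    (hY : (p.toFinset.erase x).Nonempty) (hl : ∀ y ∈ p.toFinset.erase x, 0 < l y)
    (hh : h < n) :
    ∑ b ∈ range (n - ∑ y ∈ p.toFinset.erase x, p.count y * l y + 1), ∑ a ∈ range b,
        𝔼 H ∈ powersetCard h univ, (dens (labelledFillings A n a
          (patternLabels p (Function.update l x (b - a))) H) : ℝ)
      ≤ n ^ 2 / 2
        * ∏ y ∈ p.toFinset.erase x, agreeProb (Fintype.card A) (p.count y) (h / n) ^ l y := by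
  set s := ∑ y ∈ p.toFinset.erase x, p.count y * l y
  set P := ∏ y ∈ p.toFinset.erase x, agreeProb (Fintype.card A) (p.count y) (h / n) ^ l y
  have hd1 : (h : ℝ) / n < 1 :=
    (div_lt_one (by exact_mod_cast Nat.zero_lt_of_lt hh)).2 (by exact_mod_cast hh)
  have hP0 : 0 ≤ P := prod_nonneg fun y _ =>
    pow_nonneg (agreeProb_pos Fintype.card_pos _ (by positivity) hd1).le _
  obtain hsn | hsn := lt_or_ge n s
  · rw [Nat.sub_eq_zero_of_le hsn.le]
    simpa using mul_nonneg (by positivity : (0 : ℝ) ≤ n ^ 2 / 2) hP0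
  have one_placement : ∀ b ∈ range (n - s + 1), ∀ a ∈ range b, 𝔼 H ∈ powersetCard h univ,
      (dens (labelledFillings A n a (patternLabels p (Function.update l x (b - a))) H) : ℝ)
        ≤ n / (n - s + 1) * P := by
    intro b hb a ha
    rw [mem_range] at hb ha
    exact expect_dens_labelledFillings_update_le hx hY hl (by omega) hh (by omega)
  have hsn' : (s : ℝ) ≤ n := by exact_mod_cast hsn
  have hloss : (n : ℝ) - s + 1 ≠ 0 := by linarith
  have card_placements : (∑ b ∈ range (n - s + 1), (b : ℝ)) * 2 = (n - s + 1) * (n - s) := by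
    have := congrArg (Nat.cast : ℕ → ℝ) (sum_range_id_mul_two (n - s + 1))
    push_cast [Nat.add_sub_cancel, Nat.cast_sub hsn] at this
    exact this
  calc _ ≤ ∑ b ∈ range (n - s + 1), (b : ℝ) * (n / (n - s + 1) * P) :=
        sum_le_sum fun b hb => (sum_le_card_nsmul _ _ _ (one_placement b hb)).trans_eq
          (by rw [card_range, nsmul_eq_mul])
    _ = n * (n - s) / 2 * P := by
      rw [← sum_mul, eq_div_of_mul_eq two_ne_zero card_placements]
      field_simp
    _ ≤ n ^ 2 / 2 * P := by
      gcongr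
      nlinarith [(Nat.cast_nonneg s : (0 : ℝ) ≤ s), (Nat.cast_nonneg n : (0 : ℝ) ≤ n)]

theorem PartialWord.Encounters.exists_mem_labelledFillings_update {H : Finset (Fin n)}
    {v : Fin n → A} (hx : p.count x = 1) (hw : (PartialWord.punch H v).Encounters p) :
    ∃ l : V → ℕ, (∀ y ∈ p.toFinset.erase x, l y ∈ Icc 1 n) ∧
      ∃ b ∈ range (n - ∑ y ∈ p.toFinset.erase x, p.count y * l y + 1), ∃ a ∈ range b,
        v ∈ labelledFillings A n a (patternLabels p (Function.update l x (b - a))) H := by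
  obtain ⟨l, hl, a, ha, hv⟩ := hw.exists_mem_labelledFillings
  have hlength := length_patternLabels_update hx l (l x)
  rw [Function.update_eq_self] at hlength
  have hlx := hl x
  refine ⟨l, fun y hy => mem_Icc.2 ⟨hl y, ?_⟩, a + l x, mem_range.2 (by omega), a,
    mem_range.2 (by omega), by rwa [Nat.add_sub_cancel_left, Function.update_eq_self]⟩
  have hyp : 0 < p.count y := List.count_pos_iff.2 (List.mem_toFinset.1 (mem_of_mem_erase hy))
  calc l y ≤ p.count y * l y := Nat.le_mul_of_pos_left _ hyp
    _ ≤ ∑ y ∈ p.toFinset.erase x, p.count y * l y :=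
      single_le_sum (f := fun y => p.count y * l y) (fun _ _ => Nat.zero_le _) hy
    _ ≤ n := by omega

theorem one_le_sum_dens_labelledFillings [Nonempty A] {H : Finset (Fin n)} (hx : p.count x = 1)
    (hH : ∀ v : Fin n → A, (PartialWord.punch H v).Encounters p) :
    1 ≤ ∑ l ∈ Fintype.piFinset fun _ : p.toFinset.erase x => Icc 1 n,
      ∑ b ∈ range (n - ∑ y, p.count y.1 * l y + 1), ∑ a ∈ range b,
        (dens (labelledFillings A n a
          (patternLabels p (Function.update (Function.extend Subtype.val l 0) x (b - a))) H) :
          ℝ) := by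
  set F : (p.toFinset.erase x → ℕ) → ℕ → ℕ → Finset (Fin n → A) := fun l b a =>
    labelledFillings A n a
      (patternLabels p (Function.update (Function.extend Subtype.val l 0) x (b - a))) H
  have cover : univ ⊆ (Fintype.piFinset fun _ : p.toFinset.erase x => Icc 1 n).biUnion fun l =>
      (range (n - ∑ y, p.count y.1 * l y + 1)).biUnion fun b => (range b).biUnion (F l b) := by
    intro v _
    obtain ⟨l, hl, b, hb, a, ha, hv⟩ := (hH v).exists_mem_labelledFillings_update hx
    have extend_eq : ∀ y ∈ p, Function.update l x (b - a) y = Function.update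
        (Function.extend (Subtype.val : p.toFinset.erase x → V) (fun y => l y) 0) x (b - a) y := by
      intro y hy
      by_cases hyx : y = x
      · rw [hyx, Function.update_self, Function.update_self]
      · rw [Function.update_of_ne hyx, Function.update_of_ne hyx]
        exact (Subtype.val_injective.extend_apply (fun y : p.toFinset.erase x => l y) 0
          ⟨y, mem_erase.2 ⟨hyx, List.mem_toFinset.2 hy⟩⟩).symm
    simp only [mem_biUnion]
    refine ⟨fun y => l y, Fintype.mem_piFinset.2 fun y => hl y y.2, b, ?_, a, ha, ?_⟩
    · rwa [sum_coe_sort (p.toFinset.erase x) fun y => p.count y * l y]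
    · rwa [patternLabels_congr extend_eq] at hv
  have union_bound := (dens_le_dens cover).trans <| dens_biUnion_le.trans <|
    sum_le_sum fun l _ => dens_biUnion_le.trans <| sum_le_sum fun b _ => dens_biUnion_le
  rw [dens_univ] at union_bound
  exact_mod_cast union_bound

theorem sum_expect_dens_labelledFillings_extend_le [Nonempty A] (hx : p.count x = 1)
    (hY : (p.toFinset.erase x).Nonempty) (hh : h < n) {l : p.toFinset.erase x → ℕ}
    (hl : ∀ y, 0 < l y) :
    ∑ b ∈ range (n - ∑ y, p.count y.1 * l y + 1), ∑ a ∈ range b, 𝔼 H ∈ powersetCard h univ,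
        (dens (labelledFillings A n a
          (patternLabels p (Function.update (Function.extend Subtype.val l 0) x (b - a))) H) : ℝ)
      ≤ n ^ 2 / 2 * ∏ y, agreeProb (Fintype.card A) (p.count y.1) (h / n) ^ l y := by
  have extend_apply : ∀ y : p.toFinset.erase x, Function.extend Subtype.val l 0 y.1 = l y :=
    Subtype.val_injective.extend_apply l 0
  have key := sum_expect_dens_labelledFillings_le (A := A) (l := Function.extend Subtype.val l 0)
    hx hY (fun y hy => (hl ⟨y, hy⟩).trans_eq (extend_apply ⟨y, hy⟩).symm) hh
  rw [← sum_coe_sort (p.toFinset.erase x), ← prod_coe_sort] at key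
  simp only [extend_apply] at key
  exact key

theorem sum_Icc_pow_le {q : ℝ} (hq0 : 0 < q) (hq1 : q < 1) (n : ℕ) :
    ∑ k ∈ Icc 1 n, q ^ k ≤ (1 / q - 1)⁻¹ :=
  calc ∑ k ∈ Icc 1 n, q ^ k = ∑ k ∈ Ico 1 (n + 1), q ^ k := rfl
    _ ≤ q ^ 1 / (1 - q) := geom_sum_Ico_le_of_lt_one hq0.le hq1
    _ = (1 / q - 1)⁻¹ := by
      have : 1 - q ≠ 0 := by linarith
      field_simp

theorem sum_piFinset_prod_pow_le {Y : Finset V} {q : V → ℝ} (hq0 : ∀ y ∈ Y, 0 < q y)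
    (hq1 : ∀ y ∈ Y, q y < 1) (n : ℕ) :
    ∑ l ∈ Fintype.piFinset fun _ : Y => Icc 1 n, ∏ y : Y, q y ^ l y
      ≤ (∏ y ∈ Y, (1 / q y - 1))⁻¹ := by
  rw [sum_prod_piFinset (Icc 1 n) fun (y : Y) k => q y ^ k,
    prod_coe_sort Y fun y => ∑ k ∈ Icc 1 n, q y ^ k, ← prod_inv_distrib]
  exact prod_le_prod (fun y hy => sum_nonneg fun k _ => pow_nonneg (hq0 y hy).le k)
    fun y hy => sum_Icc_pow_le (hq0 y hy) (hq1 y hy) n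

omit [DecidableEq A] in
theorem two_mul_prod_inv_agreeProb_sub_one_le_sq [Nontrivial A] (hx : p.count x = 1)
    (hY : (p.toFinset.erase x).Nonempty) (hp : ∀ y ∈ p.toFinset.erase x, 2 ≤ p.count y)
    (hh : h < n) (hH : ∀ (H : Finset (Fin n)) (v : Fin n → A), #H = h →
      (PartialWord.punch H v).Encounters p) :
    2 * ∏ y ∈ p.toFinset.erase x, (1 / agreeProb (Fintype.card A) (p.count y) (h / n) - 1)
      ≤ (n : ℝ) ^ 2 := by
  classical
  set Y := p.toFinset.erase x
  set q : V → ℝ := fun y => agreeProb (Fintype.card A) (p.count y) (h / n)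
  have hn : (0 : ℝ) < n := by exact_mod_cast Nat.zero_lt_of_lt hh
  have hd0 : 0 ≤ (h : ℝ) / n := by positivity
  have hd1 : (h : ℝ) / n < 1 := (div_lt_one hn).2 (by exact_mod_cast hh)
  have hq0 : ∀ y ∈ Y, 0 < q y := fun y _ => agreeProb_pos Fintype.card_pos _ hd0 hd1
  have hq1 : ∀ y ∈ Y, q y < 1 := fun y hy =>
    agreeProb_lt_one Fintype.one_lt_card (hp y hy) hd0 hd1
  have prod_pos : 0 < ∏ y ∈ Y, (1 / q y - 1) := prod_pos fun y hy => by
    rw [sub_pos, lt_div_iff₀ (hq0 y hy), one_mul]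
    exact hq1 y hy
  set Λ := Fintype.piFinset fun _ : Y => Icc 1 n
  have first_moment : 1 ≤ (n : ℝ) ^ 2 / 2 * (∏ y ∈ Y, (1 / q y - 1))⁻¹ :=
    calc (1 : ℝ) = 𝔼 _H ∈ powersetCard h (univ : Finset (Fin n)), (1 : ℝ) :=
          (expect_const (powersetCard_nonempty.2 (by simpa using hh.le)) _).symm
      _ ≤ 𝔼 H ∈ powersetCard h (univ : Finset (Fin n)), _ := expect_le_expect fun H hcard =>
          one_le_sum_dens_labelledFillings hx fun v => hH H v (mem_powersetCard.1 hcard).2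
      _ ≤ ∑ l ∈ Λ, n ^ 2 / 2 * ∏ y : Y, q y ^ l y := by
          simp only [expect_sum_comm]
          exact sum_le_sum fun l hl => sum_expect_dens_labelledFillings_extend_le hx hY hh
            fun y => (mem_Icc.1 (Fintype.mem_piFinset.1 hl y)).1
      _ ≤ n ^ 2 / 2 * (∏ y ∈ Y, (1 / q y - 1))⁻¹ := by
          rw [← mul_sum]
          exact mul_le_mul_of_nonneg_left (sum_piFinset_prod_pow_le hq0 hq1 n) (by positivity)
  rw [← div_eq_mul_inv, le_div_iff₀ prod_pos] at first_moment
  linarith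

end FirstMoment

section Zimin

theorem mem_zimin {i t : ℕ} : t ∈ zimin i ↔ t ∈ Icc 1 i := by
  induction i with
  | zero => simp [zimin]
  | succ i ih =>
    simp only [zimin, List.mem_append, List.mem_singleton, ih, mem_Icc]
    omega

theorem toFinset_zimin (i : ℕ) : (zimin i).toFinset = Icc 1 i := by
  ext t
  rw [List.mem_toFinset, mem_zimin]

theorem count_zimin {i t : ℕ} (ht : t ∈ Icc 1 i) : (zimin i).count t = 2 ^ (i - t) := by
  induction i with
  | zero => simp at ht
  | succ i ih =>
    obtain ⟨ht1, hti⟩ := mem_Icc.1 ht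
    rw [zimin, List.count_append, List.count_append, List.count_singleton]
    obtain rfl | hti := hti.eq_or_lt
    · rw [List.count_eq_zero.2 (mem_zimin.not.2 (by simp))]
      simp
    · rw [ih (mem_Icc.2 ⟨ht1, by omega⟩), if_neg (by simpa using hti.ne'), add_zero, ← mul_two,
        ← pow_succ, Nat.succ_sub (by omega)]

theorem flatMap_update_zimin_succ {A : Type*} (h : ℕ → List A) (i : ℕ) (g : List A) :
    (zimin (i + 1)).flatMap (Function.update h (i + 1) g)
      = (zimin i).flatMap h ++ g ++ (zimin i).flatMap h := by
  have unchanged : (zimin i).flatMap (Function.update h (i + 1) g) = (zimin i).flatMap h :=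
    List.flatMap_congr fun t ht =>
      Function.update_of_ne (by have := mem_Icc.1 (mem_zimin.1 ht); omega) _ _
  rw [zimin, List.flatMap_append, List.flatMap_append, List.flatMap_singleton, unchanged,
    Function.update_self]

/-- A pattern is unavoidable over `A` if all sufficiently long words over `A` contain its image
under a nonerasing morphism. -/
def IsUnavoidable {V : Type*} (A : Type*) (p : List V) : Prop :=
  ∃ N, ∀ w : List A, N ≤ w.length → ∃ h : V → List A, (∀ x, h x ≠ []) ∧ p.flatMap h <:+: w

theorem append_append_infix_of_take_drop_eq {A : Type*} {w : List A} {N a b : ℕ} (hab : a + N ≤ b)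
    (heq : (w.drop a).take N = (w.drop b).take N) :
    (w.drop b).take N ++ (w.drop (a + N)).take (b - (a + N)) ++ (w.drop b).take N <:+: w := by
  refine ⟨w.take a, w.drop (b + N), ?_⟩
  have first : (w.drop b).take N ++ w.drop (a + N) = w.drop a := by
    rw [← heq, ← List.drop_drop, List.take_append_drop]
  have between : (w.drop (a + N)).take (b - (a + N)) ++ w.drop b = w.drop (a + N) := by
    have : w.drop b = (w.drop (a + N)).drop (b - (a + N)) := by
      rw [List.drop_drop, Nat.add_sub_cancel' hab]
    rw [this, List.take_append_drop]
  have second : (w.drop b).take N ++ w.drop (b + N) = w.drop b := by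
    rw [← List.drop_drop, List.take_append_drop]
  simp only [List.append_assoc]
  rw [second, between, first, List.take_append_drop]

theorem exists_append_append_infix (A : Type*) [Finite A] (N : ℕ) :
    ∃ M, ∀ w : List A, M ≤ w.length →
      ∃ B g : List A, B.length = N ∧ g ≠ [] ∧ B ++ g ++ B <:+: w := by
  have := Fintype.ofFinite (List.Vector A N)
  set K := Fintype.card (List.Vector A N)
  refine ⟨(K + 1) * (N + 1), fun w hw => ?_⟩
  have block_fits : ∀ c : Fin (K + 1), c * (N + 1) + (N + 1) ≤ w.length := fun c =>
    (Nat.succ_mul c _).symm.trans_le ((Nat.mul_le_mul_right _ c.2).trans hw)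
  have length_block : ∀ c : Fin (K + 1), ((w.drop (c * (N + 1))).take N).length = N := fun c => by
    have := block_fits c
    rw [List.length_take, List.length_drop]
    omega
  let block : Fin (K + 1) → List.Vector A N := fun c => ⟨_, length_block c⟩
  obtain ⟨a, b, hne, hblock⟩ := Fintype.exists_ne_map_eq_of_card_lt block (by simp [K])
  wlog hab : a < b generalizing a b
  · exact this b a hne.symm hblock.symm (lt_of_le_of_ne (not_lt.1 hab) hne.symm)
  have gap : a * (N + 1) + (N + 1) ≤ b * (N + 1) :=
    (Nat.succ_mul a _).symm.trans_le (Nat.mul_le_mul_right _ hab)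
  have := block_fits b
  refine ⟨_, _, length_block b, ?_, append_append_infix_of_take_drop_eq
    (a := a * (N + 1)) (by omega) (congrArg Subtype.val hblock)⟩
  rw [← List.length_pos_iff, List.length_take, List.length_drop]
  omega

theorem isUnavoidable_zimin (A : Type*) [Finite A] [Nonempty A] (i : ℕ) :
    IsUnavoidable A (zimin i) := by
  induction i with
  | zero =>
    obtain ⟨a⟩ := ‹Nonempty A›
    exact ⟨0, fun w _ => ⟨fun _ => [a], by simp, by simp [zimin]⟩⟩
  | succ i ih =>
    obtain ⟨N, hN⟩ := ih
    obtain ⟨M, hM⟩ := exists_append_append_infix A N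
    refine ⟨M, fun w hw => ?_⟩
    obtain ⟨B, g, hB, hg, hBgB⟩ := hM w hw
    obtain ⟨h, hne, u, v, rfl⟩ := hN B hB.ge
    -- `B = u h(Zᵢ) v`, hence `B g B` contains `h(Zᵢ) (v g u) h(Zᵢ)`.
    refine ⟨Function.update h (i + 1) (v ++ g ++ u), fun t => ?_, ?_⟩
    · obtain rfl | ht := eq_or_ne t (i + 1)
      · simp [hg]
      · rw [Function.update_of_ne ht]
        exact hne t
    · rw [flatMap_update_zimin_succ]
      exact List.IsInfix.trans ⟨u, v, by simp only [List.append_assoc]⟩ hBgB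

end Zimin

section RamseyLength

variable {V A : Type*} {p : List V}

theorem PartialWord.compatible_ofWord_map_getD (a : A) (f : PartialWord A) :
    PartialWord.Compatible f (PartialWord.ofWord (f.map fun x => x.getD a)) := by
  rw [PartialWord.Compatible, PartialWord.ofWord, List.map_map, List.forall₂_map_right_iff,
    List.forall₂_same]
  rintro x - b c rfl h
  simpa using h

theorem PartialWord.encounters_of_flatMap_infix_map_getD {a : A} {w : PartialWord A}
    {h : V → List A} (hne : ∀ x, h x ≠ []) (hw : p.flatMap h <:+: w.map fun x => x.getD a) :
    w.Encounters p := by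
  obtain ⟨f, hf, heq⟩ := List.infix_map_iff.1 hw
  exact ⟨h, hne, f, hf, heq ▸ PartialWord.compatible_ofWord_map_getD a f⟩

theorem IsUnavoidable.exists_forall_encounters [Nonempty A] (hp : IsUnavoidable A p) :
    ∃ N, ∀ w : PartialWord A, N ≤ w.length → w.Encounters p := by
  obtain ⟨a⟩ := ‹Nonempty A›
  obtain ⟨N, hN⟩ := hp
  refine ⟨N, fun w hw => ?_⟩
  obtain ⟨h, hne, hinfix⟩ := hN (w.map fun x => x.getD a) (by rwa [List.length_map])
  exact PartialWord.encounters_of_flatMap_infix_map_getD hne hinfix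

theorem PartialWord.exists_length_eq_holeDensity_eq (A : Type*) [Nonempty A] {d : ℚ}
    (hd0 : 0 ≤ d) (hd1 : d ≤ 1) {k : ℕ} (hk : 0 < k) :
    ∃ w : PartialWord A, w.length = d.den * k ∧ w.holeDensity = d := by
  obtain ⟨a⟩ := ‹Nonempty A›
  have hnum : (d.num.toNat : ℚ) = d.num := by
    exact_mod_cast Int.toNat_of_nonneg (Rat.num_nonneg.2 hd0)
  have hle : d.num.toNat ≤ d.den := by
    have : d.num ≤ d.den := Rat.num_le_denom_iff.2 hd1
    omega
  obtain ⟨H, -, hH⟩ := exists_subset_card_eq (s := (univ : Finset (Fin (d.den * k))))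
    (n := d.num.toNat * k) (by simpa using Nat.mul_le_mul_right k hle)
  refine ⟨punch H fun _ => a, length_punch _ _, ?_⟩
  have hk' : (k : ℚ) ≠ 0 := by exact_mod_cast hk.ne'
  rw [holeDensity_punch, hH]
  push_cast
  rw [hnum, mul_div_mul_right _ _ hk', Rat.num_div_den]

theorem partialRamseyLength_spec {m : ℕ} {d : ℚ} (hm : 0 < m) (hd0 : 0 ≤ d) (hd1 : d ≤ 1)
    (hp : IsUnavoidable (Fin m) p) :
    0 < partialRamseyLength d m p ∧
      (∃ w : PartialWord (Fin m), w.length = partialRamseyLength d m p ∧ w.holeDensity = d) ∧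
      ∀ w : PartialWord (Fin m), w.length = partialRamseyLength d m p → w.holeDensity = d →
        w.Encounters p := by
  have : Nonempty (Fin m) := ⟨⟨0, hm⟩⟩
  obtain ⟨N, hN⟩ := hp.exists_forall_encounters
  have nonempty : {n : ℕ | 0 < n ∧
      (∃ w : PartialWord (Fin m), w.length = n ∧ w.holeDensity = d) ∧
      ∀ w : PartialWord (Fin m), w.length = n → w.holeDensity = d → w.Encounters p}.Nonempty :=
    ⟨d.den * (N + 1), Nat.mul_pos d.den_pos N.succ_pos,
      PartialWord.exists_length_eq_holeDensity_eq _ hd0 hd1 N.succ_pos,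
      fun w hw _ => hN w (hw ▸ N.le_succ.trans (Nat.le_mul_of_pos_left _ d.den_pos))⟩
  exact Nat.sInf_mem nonempty

theorem exists_card_holes_partialRamseyLength {m : ℕ} {d : ℚ} (hm : 0 < m) (hd0 : 0 ≤ d)
    (hd1 : d ≤ 1) (hp : IsUnavoidable (Fin m) p) :
    ∃ h : ℕ, d = (h : ℚ) / partialRamseyLength d m p := by
  obtain ⟨-, ⟨w, hlength, hdensity⟩, -⟩ := partialRamseyLength_spec hm hd0 hd1 hp
  exact ⟨w.countP Option.isNone, by rw [← hlength, ← hdensity]; rfl⟩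

end RamseyLength

section LowerBound

theorem prod_Icc_erase_self_eq_prod_Icc (i : ℕ) (f : ℕ → ℝ) :
    ∏ t ∈ (Icc 1 i).erase i, f (i - t) = ∏ j ∈ Icc 1 (i - 1), f j := by
  refine prod_nbij' (i - ·) (i - ·) ?_ ?_ ?_ ?_ fun _ _ => rfl <;>
    simp only [mem_erase, mem_Icc] <;> omega

theorem two_mul_prod_inv_agreeProb_sub_one_le_sq_of_zimin {m i n h : ℕ} (hm : 2 ≤ m) (hi : 2 ≤ i)
    (hh : h < n)
    (hH : ∀ w : PartialWord (Fin m), w.length = n → w.holeDensity = (h : ℚ) / n →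
      w.Encounters (zimin i)) :
    2 * ∏ j ∈ Icc 1 (i - 1), (1 / agreeProb m (2 ^ j) (h / n) - 1) ≤ (n : ℝ) ^ 2 := by
  have : Nontrivial (Fin m) := Fin.nontrivial_iff_two_le.2 hm
  have count_of_mem : ∀ t ∈ (Icc 1 i).erase i, (zimin i).count t = 2 ^ (i - t) :=
    fun t ht => count_zimin (mem_of_mem_erase ht)
  have bound := two_mul_prod_inv_agreeProb_sub_one_le_sq (A := Fin m) (p := zimin i) (x := i)
    (by rw [count_zimin (mem_Icc.2 ⟨by omega, le_rfl⟩), Nat.sub_self, pow_zero])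
    (by rw [toFinset_zimin]; exact ⟨1, mem_erase.2 ⟨by omega, mem_Icc.2 ⟨le_rfl, by omega⟩⟩⟩)
    (by
      rw [toFinset_zimin]
      intro t ht
      rw [count_of_mem t ht]
      obtain ⟨hti, ht⟩ := mem_erase.1 ht
      exact Nat.le_self_pow (by have := mem_Icc.1 ht; omega) 2)
    hh fun H v hcard =>
      hH _ (PartialWord.length_punch H v) (by rw [PartialWord.holeDensity_punch, hcard])
  rwa [toFinset_zimin, Fintype.card_fin, prod_congr rfl fun t ht => by rw [count_of_mem t ht],
    prod_Icc_erase_self_eq_prod_Icc i fun j => 1 / agreeProb m (2 ^ j) (h / n) - 1] at bound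

theorem two_mul_prod_inv_agreeProb_sub_one_le_partialRamseyLength_sq {m i : ℕ} {d : ℚ}
    (hm : 1 ≤ m) (hd0 : 0 ≤ d) (hd1 : d < 1) (hid : 2 ≤ i ∨ 0 < d) :
    2 * ∏ j ∈ Icc 1 (i - 1), (1 / agreeProb m (2 ^ j) d - 1)
      ≤ (partialRamseyLength d m (zimin i) : ℝ) ^ 2 := by
  have : Nonempty (Fin m) := ⟨⟨0, hm⟩⟩
  have hp := isUnavoidable_zimin (Fin m) i
  obtain ⟨hn, -, hencounter⟩ := partialRamseyLength_spec hm hd0 hd1.le hp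
  obtain ⟨h, hh⟩ := exists_card_holes_partialRamseyLength hm hd0 hd1.le hp
  generalize partialRamseyLength d m (zimin i) = n at *
  have hn' : (0 : ℚ) < n := by exact_mod_cast hn
  have hhn : h < n := by exact_mod_cast (div_lt_one hn').1 (hh ▸ hd1)
  obtain hi | hi := lt_or_ge i 2
  · have hh0 : 0 < h := Nat.pos_of_ne_zero fun h0 =>
      (hid.resolve_left hi.not_ge).ne' (by rw [hh, h0, Nat.cast_zero, zero_div])
    have : (2 : ℝ) ≤ n := by exact_mod_cast (by omega : 2 ≤ n)
    rw [Icc_eq_empty (by omega), prod_empty]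
    nlinarith
  obtain rfl | hm := eq_or_lt_of_le hm
  · rw [prod_eq_zero (mem_Icc.2 ⟨le_rfl, by omega⟩)
      (by rw [agreeProb_one_left, div_one, sub_self]), mul_zero]
    positivity
  · rw [hh, Rat.cast_div, Rat.cast_natCast, Rat.cast_natCast]
    exact two_mul_prod_inv_agreeProb_sub_one_le_sq_of_zimin hm hi hhn fun w hw hd =>
      hencounter w hw (hd.trans hh.symm)

theorem mainTheorem12_general (m i : ℕ) (d : ℚ) (hm : 1 ≤ m) (hd0 : 0 ≤ d) (hd1 : d < 1)
    (hid : 2 ≤ i ∨ 0 < d) :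
    Real.sqrt (2 * ∏ j ∈ Icc 1 (i - 1),
        ((m : ℝ) ^ (2 ^ j - 1) /
          ((1 + (d : ℝ) * ((m : ℝ) - 1)) ^ (2 ^ j)
            - (1 - 1 / (m : ℝ)) * ((m : ℝ) * (d : ℝ)) ^ (2 ^ j)) - 1))
      ≤ (partialRamseyLength d m (zimin i) : ℝ) := by
  rw [Real.sqrt_le_left (Nat.cast_nonneg _),
    prod_congr rfl fun j _ => (inv_agreeProb_sub_one_eq hm (by positivity) (d : ℝ)).symm]
  exact two_mul_prod_inv_agreeProb_sub_one_le_partialRamseyLength_sq hm hd0 hd1 hid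

end LowerBound

theorem mainTheorem12 :
    ∃ δ : ℕ × ℕ × ℚ → ℝ,
      Filter.Tendsto δ
        (Filter.comap (fun t : ℕ × ℕ × ℚ => max t.1 t.2.1) Filter.atTop) (nhds 0) ∧
      ∀ (m i : ℕ) (d : ℚ), 1 ≤ m → 1 ≤ i → 0 < d → d < 1 →
        (1 + δ (m, i, d)) *
            Real.sqrt (2 * ∏ j ∈ Finset.Icc 1 (i - 1),
              ((m : ℝ) ^ (2 ^ j - 1) /
                ((1 + (d : ℝ) * ((m : ℝ) - 1)) ^ (2 ^ j)
                  - (1 - 1 / (m : ℝ)) * ((m : ℝ) * (d : ℝ)) ^ (2 ^ j)) - 1))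
          ≤ (partialRamseyLength d m (zimin i) : ℝ) := by
  refine ⟨fun _ => 0, tendsto_const_nhds, fun m i d hm _ hd0 hd1 => ?_⟩
  rw [add_zero, one_mul]
  exact mainTheorem12_general m i d hm hd0.le hd1 (Or.inr hd0)
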